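/- A partition $\lambda$ (the empty partition $\emptyset$, of size $0$, is allowed) is a finite non-increasing sequence $\lambda_1\ge\lambda_2\ge\cdots\ge\lambda_\ell$ of positive integers; its size is $|\lambda|=\sum_i\lambda_i$. It is self-conjugate if its Young diagram is symmetric about the main diagonal. The hook length of a box of the Young diagram is the number of boxes directly to its right plus the number of boxes directly below it plus one. For a positive integer $t$, $\lambda$ is a $t$-core if none of its hook lengths is divisible by $t$, and a $(t,t+1)$-core if it is both a $t$-core and a $(t+1)$-core. Let $s(\lambda)$ be the size of the Durfee square of $\lambda$, i.e. the largest integer $s\ge 0$ such that at least $s$ parts of $\lambda$ are $\ge s$. Let $\mathcal{DS}(t)$ be the set of self-conjugate $(t,t+1)$-core partitions whose first $s(\lambda)$ parts are pairwise distinct (so $\emptyset\in\mathcal{DS}(t)$). Theorem 1.3. Let $t$ be a positive integer. The sizes of the partitions in $\mathcal{DS}(t)$ have a maximum $m(t)$, with $m(1)=0$, $m(2)=1$, and $m(t)=2t-1$ for $3\le t\le 5$. For $t\ge 6$, put $q=\left\lfloor \frac{2t+1}{12}\right\rfloor$. Then: 1. If $t$ is even and $\frac t2-1-2q\equiv 0\pmod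 3$, or $t$ is odd and $\frac{t-1}2-2q\equiv 2\pmod 3$, then $$m(t)=\tfrac13(t-1)(t+1-4q)+q(2t+1-2q).$$ 2. If $t$ is even and $\frac t2-1-2q\equiv 1\pmod 3$, or $t$ is odd and $\frac{t-1}2-2q\equiv 0\pmod 3$, then $$m(t)=\tfrac13(t-1)(t-7-4q)+(q+2)(2t-3-2q).$$ 3. If $t$ is even and $\frac t2-1-2q\equiv 2\pmod 3$, or $t$ is odd and $\frac{t-1}2-2q\equiv 1\pmod 3$, then $$m(t)=\tfrac13(t-1)(t-3-4q)+(q+1)(2t-1-2q).$$ Moreover, for every $t\ge 1$ there is exactly one partition in $\mathcal{DS}(t)$ of size $m(t)$. -/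

import Mathlib

namespace SelfConjCore

/-- Partitions are encoded by their Young diagrams (finite lower sets of cells `(i, j)`, row `i` and
column `j`, both starting at `0`); `μ.rowLen i` is the `i`-th part and `μ.card` the size. The empty
partition is the empty diagram. A partition is self-conjugate if its diagram equals its transpose. -/
def IsSelfConjugate (μ : YoungDiagram) : Prop :=
  μ.transpose = μ

/-- The hook length of a cell `(i, j)` of `μ`: the number of cells strictly to the right in row `i`,
plus the number of cells strictly below in column `j`, plus one for the cell itself. -/
def hookLength (μ : YoungDiagram) (i j : ℕ) : ℕ :=
  (μ.rowLen i - (j + 1)) + (μ.colLen j - (i + 1)) + 1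

/-- `μ` is a `t`-core if no hook length of a cell of `μ` is divisible by `t`. -/
def IsCore (t : ℕ) (μ : YoungDiagram) : Prop :=
  ∀ c ∈ μ.cells, ¬ t ∣ hookLength μ c.1 c.2

/-- The size of the Durfee square: the largest `s` such that at least `s` of the parts
(the row lengths) are at least `s`. The bound `μ.card` of the search is harmless,
see `isGreatest_durfeeSize`. -/
def durfeeSize (μ : YoungDiagram) : ℕ :=
  Nat.findGreatest (fun s => s ≤ μ.rowLens.countP (fun p => s ≤ p)) μ.card

theorem isGreatest_durfeeSize (μ : YoungDiagram) :
    IsGreatest {s : ℕ | s ≤ μ.rowLens.countP (fun p => s ≤ p)} (durfeeSize μ) := by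
  constructor
  · have h := Nat.findGreatest_spec (P := fun s => s ≤ μ.rowLens.countP (fun p => s ≤ p))
      (Nat.zero_le μ.card) (Nat.zero_le _)
    exact h
  · intro s hs
    refine Nat.le_findGreatest ?_ hs
    have h1 : s ≤ μ.colLen 0 := by
      have h2 : μ.rowLens.countP (fun p => decide (s ≤ p)) ≤ μ.rowLens.length :=
        List.countP_le_length
      rw [YoungDiagram.length_rowLens] at h2
      exact le_trans hs h2
    rw [YoungDiagram.colLen_eq_card] at h1
    exact h1.trans (Finset.card_le_card (Finset.filter_subset _ _))

/-- The set `DS(t)` of self-conjugate `(t, t+1)`-core partitions whose first `s` parts are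
pairwise distinct, where `s` is the size of the Durfee square. -/
def DS (t : ℕ) : Set YoungDiagram :=
  {μ | IsSelfConjugate μ ∧ IsCore t μ ∧ IsCore (t + 1) μ ∧
    Set.InjOn μ.rowLen (Set.Iio (durfeeSize μ))}

/-- The set of sizes of the partitions in `DS(t)`. -/
def sizes (t : ℕ) : Set ℕ :=
  YoungDiagram.card '' DS t

/-- The largest size of a partition in `DS(t)`. -/
noncomputable def largestSize (t : ℕ) : ℕ :=
  sSup (sizes t)

end SelfConjCore

/-!
A self-conjugate partition is determined by the set `D` of the arm lengths of its diagonal cells,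
and its size is the sum of the diagonal hook lengths `2 * a + 1` over `a ∈ D`
(`IsSelfConjugate.card_eq`, `eq_of_arms_eq`, `arms_ofArms`). Closure of `D` under subtraction of
`t` and of `t + 1` would give two consecutive arms below any arm larger than `t`, and consecutive
arms mean equal parts. Hence membership in `DS t` says precisely that `D ⊆ {0, …, t - 1}`, that no
two elements of `D` are consecutive, and that no two elements, equal ones included, have sum `t - 1`
or `t` (`mem_DS_iff`).

Arrange the numbers below `t` in the path `0, t - 1, 1, t - 2, 2, …`. The forbidden pairs are those
at distance `1` or `2` in this path, and its last element is forbidden. Numbering the path from its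
end by `j = 0, …, t - 1`, the problem becomes to choose positions in `{1, …, t - 1}` with gaps at
least `3` of largest total weight, where the weight of `j` is `t + 1 + j` if `j ≡ t (mod 2)` and
`t - j` otherwise (`IsUniqueOptimum.isGreatest_and_existsUnique`).

Heavy positions alone need gaps of length `4`, which pays off far from the end of the path, where
the weights of the two classes differ most; near the end, the largest possible number of positions
is preferable. So the optimum is `1, 4, …, 3 * K - 2` followed by steps of length `4` up to `t - 2`,
where `t = 3 * K + 4 * r` and `-22 ≤ t - 9 * K ≤ 12`; this determines `K`, since `K ≡ -t (mod 4)`.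
Optimality and uniqueness are both proved by an explicit supersolution of the dynamic programming
recursion which is strict at all positions outside the optimum (`sum_le_of_certificate`,
`isUniqueOptimum_extremalSet`). Comparing `r` with `q` gives `r = q - 1`, `q + 1`, `q` in the three
cases of the theorem. The values `t = 1, 2, 5`, where there are no such `K` and `r`, are checked
directly.
-/

namespace SelfConjCore

/-! ### Arms of a self-conjugate diagram -/

theorem succ_le_countP_rowLens_iff (μ : YoungDiagram) (s : ℕ) :
    s + 1 ≤ μ.rowLens.countP (fun p => s + 1 ≤ p) ↔ (s, s) ∈ μ := by
  have h : μ.rowLens.countP (fun p => s + 1 ≤ p) = μ.colLen s := by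
    have h1 : μ.rowLens.countP (fun p => s + 1 ≤ p) =
        Nat.count (fun i => s + 1 ≤ μ.rowLen i) (μ.colLen 0) := by
      rw [YoungDiagram.rowLens, List.countP_map, Nat.count]
      rfl
    rw [h1, Nat.count_eq_card_filter_range, ← Finset.card_range (μ.colLen s)]
    congr 1
    ext i
    simp only [Finset.mem_filter, Finset.mem_range, Nat.succ_le_iff,
      ← YoungDiagram.mem_iff_lt_rowLen, ← YoungDiagram.mem_iff_lt_colLen]
    exact ⟨fun h => h.2, fun h => ⟨μ.up_left_mem le_rfl (Nat.zero_le _) h, h⟩⟩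
  rw [h, YoungDiagram.mem_iff_lt_colLen, Nat.succ_le_iff]

theorem diag_mem_iff (μ : YoungDiagram) (i : ℕ) : (i, i) ∈ μ ↔ i < durfeeSize μ := by
  obtain ⟨h1, h2⟩ := isGreatest_durfeeSize μ
  constructor
  · intro h
    exact h2 ((succ_le_countP_rowLens_iff μ i).2 h)
  · intro h
    obtain ⟨s, hs⟩ : ∃ s, durfeeSize μ = s + 1 := ⟨durfeeSize μ - 1, by omega⟩
    rw [hs] at h1
    have := (succ_le_countP_rowLens_iff μ s).1 h1
    exact μ.up_left_mem (by omega) (by omega) this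

/-- The Frobenius arm lengths of `μ`: the numbers of cells strictly to the right of the diagonal
cells. For a self-conjugate diagram they are also the leg lengths. -/
def arms (μ : YoungDiagram) : Finset ℕ :=
  (Finset.range (durfeeSize μ)).image fun i => μ.rowLen i - (i + 1)

theorem lt_rowLen_of_lt_durfeeSize {μ : YoungDiagram} {i : ℕ} (h : i < durfeeSize μ) :
    i < μ.rowLen i :=
  μ.mem_iff_lt_rowLen.1 ((diag_mem_iff μ i).2 h)

theorem mem_arms_iff {μ : YoungDiagram} {x : ℕ} :
    x ∈ arms μ ↔ ∃ i, μ.rowLen i = i + 1 + x := by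
  simp only [arms, Finset.mem_image, Finset.mem_range]
  constructor
  · rintro ⟨i, hi, h⟩
    have := lt_rowLen_of_lt_durfeeSize hi
    exact ⟨i, by omega⟩
  · rintro ⟨i, hi⟩
    refine ⟨i, (diag_mem_iff μ i).1 (μ.mem_iff_lt_rowLen.2 (by omega)), by omega⟩

theorem injOn_arm (μ : YoungDiagram) :
    Set.InjOn (fun i => μ.rowLen i - (i + 1)) (Finset.range (durfeeSize μ)) := by
  intro i hi j hj h
  simp only [Finset.coe_range, Set.mem_Iio] at hi hj h
  have h1 := lt_rowLen_of_lt_durfeeSize hi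
  have h2 := lt_rowLen_of_lt_durfeeSize hj
  rcases le_total i j with hij | hij
  · have := μ.rowLen_anti _ _ hij
    omega
  · have := μ.rowLen_anti _ _ hij
    omega

theorem IsSelfConjugate.mem_comm {μ : YoungDiagram} (h : IsSelfConjugate μ) {i j : ℕ} :
    (i, j) ∈ μ ↔ (j, i) ∈ μ := by
  conv_lhs => rw [← h]
  rw [YoungDiagram.mem_transpose]
  rfl

theorem IsSelfConjugate.colLen_eq {μ : YoungDiagram} (h : IsSelfConjugate μ) (i : ℕ) :
    μ.colLen i = μ.rowLen i := by
  conv_lhs => rw [← h]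
  exact μ.colLen_transpose i

/-- The size of a self-conjugate partition is the sum of its diagonal hook lengths. -/
theorem IsSelfConjugate.card_eq {μ : YoungDiagram} (h : IsSelfConjugate μ) :
    μ.card = ∑ a ∈ arms μ, (2 * a + 1) := by
  rw [arms, Finset.sum_image (injOn_arm μ)]
  have hmaps : ∀ c ∈ μ.cells, min c.1 c.2 ∈ Finset.range (durfeeSize μ) := by
    intro c hc
    rw [Finset.mem_range, ← diag_mem_iff]
    exact μ.up_left_mem (min_le_left _ _) (min_le_right _ _) ((YoungDiagram.mem_cells _).1 hc)
  rw [YoungDiagram.card, Finset.card_eq_sum_card_fiberwise hmaps]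
  refine Finset.sum_congr rfl fun i hi => ?_
  have hi' := lt_rowLen_of_lt_durfeeSize (Finset.mem_range.1 hi)
  have hfib : {c ∈ μ.cells | min c.1 c.2 = i} =
      (Finset.Ico i (μ.rowLen i)).image (fun j => (i, j)) ∪
        (Finset.Ico (i + 1) (μ.rowLen i)).image (fun j => (j, i)) := by
    ext ⟨a, b⟩
    simp only [Finset.mem_filter, YoungDiagram.mem_cells, Finset.mem_union, Finset.mem_image,
      Finset.mem_Ico, Prod.mk.injEq]
    constructor
    · rintro ⟨hm, hab⟩
      rcases le_or_gt a b with hle | hlt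
      · rw [min_eq_left hle] at hab
        subst hab
        exact Or.inl ⟨b, ⟨hle, μ.mem_iff_lt_rowLen.1 hm⟩, rfl, rfl⟩
      · rw [min_eq_right hlt.le] at hab
        subst hab
        exact Or.inr ⟨a, ⟨hlt, μ.mem_iff_lt_rowLen.1 (h.mem_comm.1 hm)⟩, rfl, rfl⟩
    · rintro (⟨j, ⟨h1, h2⟩, rfl, rfl⟩ | ⟨j, ⟨h1, h2⟩, rfl, rfl⟩)
      · exact ⟨μ.mem_iff_lt_rowLen.2 h2, min_eq_left h1⟩
      · exact ⟨h.mem_comm.1 (μ.mem_iff_lt_rowLen.2 h2), min_eq_right (by omega)⟩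
  rw [hfib, Finset.card_union_of_disjoint, Finset.card_image_of_injective,
    Finset.card_image_of_injective, Nat.card_Ico, Nat.card_Ico]
  · omega
  · intro x y hxy
    simpa using hxy
  · intro x y hxy
    simpa using hxy
  · rw [Finset.disjoint_left]
    simp only [Finset.mem_image, Finset.mem_Ico, not_exists, not_and]
    rintro c ⟨j, hj, rfl⟩ k hk heq
    simp only [Prod.mk.injEq] at heq
    omega

/-- The number of elements of `D` that are at least `m`; for `D = arms μ` this is the number of
cells of `μ` on the `m`-th diagonal above the main one. -/
def tailCard (D : Finset ℕ) (m : ℕ) : ℕ := ({x ∈ D | m ≤ x} : Finset ℕ).card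

theorem tailCard_succ (D : Finset ℕ) (m : ℕ) :
    tailCard D m = tailCard D (m + 1) + if m ∈ D then 1 else 0 := by
  have : ({x ∈ D | m ≤ x} : Finset ℕ) =
      {x ∈ D | m + 1 ≤ x} ∪ (if m ∈ D then {m} else ∅) := by
    ext x
    split_ifs with h
    · simp only [Finset.mem_filter, Finset.mem_union, Finset.mem_singleton]
      constructor
      · rintro ⟨h1, h2⟩
        by_cases hx : x = m
        · exact Or.inr hx
        · exact Or.inl ⟨h1, by omega⟩
      · rintro (⟨h1, h2⟩ | rfl)
        · exact ⟨h1, by omega⟩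
        · exact ⟨h, le_rfl⟩
    · simp only [Finset.mem_filter, Finset.union_empty, and_congr_right_iff]
      intro hx
      have : x ≠ m := fun hh => h (hh ▸ hx)
      omega
  rw [tailCard, this, Finset.card_union_of_disjoint, tailCard]
  · split_ifs <;> simp
  · split_ifs <;> simp

theorem tailCard_anti (D : Finset ℕ) : Antitone (tailCard D) :=
  antitone_nat_of_succ_le fun m => by rw [tailCard_succ D m]; omega

theorem mem_diagonal_iff_lt_tailCard (μ : YoungDiagram) (p m : ℕ) :
    (p, p + m) ∈ μ ↔ p < tailCard (arms μ) m := by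
  have hset : ({x ∈ arms μ | m ≤ x} : Finset ℕ) =
      ({i ∈ Finset.range (durfeeSize μ) | (i, i + m) ∈ μ}).image
        fun i => μ.rowLen i - (i + 1) := by
    ext x
    simp only [arms, Finset.mem_filter, Finset.mem_image, Finset.mem_range,
      YoungDiagram.mem_iff_lt_rowLen]
    constructor
    · rintro ⟨⟨i, hi, rfl⟩, hm⟩
      have := lt_rowLen_of_lt_durfeeSize hi
      exact ⟨i, ⟨hi, by omega⟩, rfl⟩
    · rintro ⟨i, ⟨hi, h⟩, rfl⟩
      exact ⟨⟨i, hi, rfl⟩, by omega⟩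
  have hcard : tailCard (arms μ) m =
      ({i ∈ Finset.range (durfeeSize μ) | (i, i + m) ∈ μ} : Finset ℕ).card := by
    rw [tailCard, hset, Finset.card_image_of_injOn]
    exact (injOn_arm μ).mono (Finset.coe_subset.2 (Finset.filter_subset _ _))
  rw [hcard]
  have hiff : ∀ i, i ∈ ({i ∈ Finset.range (durfeeSize μ) | (i, i + m) ∈ μ} : Finset ℕ) ↔
      (i, i + m) ∈ μ := by
    intro i
    simp only [Finset.mem_filter, Finset.mem_range, and_iff_right_iff_imp, ← diag_mem_iff]
    exact μ.up_left_mem le_rfl (by omega)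
  constructor
  · intro h
    have hsub : Finset.range (p + 1) ⊆
        ({i ∈ Finset.range (durfeeSize μ) | (i, i + m) ∈ μ} : Finset ℕ) := by
      intro i hi
      rw [Finset.mem_range] at hi
      exact (hiff i).2 (μ.up_left_mem (by omega) (by omega) h)
    simpa using Finset.card_le_card hsub
  · intro h
    by_contra hp
    have hsub : ({i ∈ Finset.range (durfeeSize μ) | (i, i + m) ∈ μ} : Finset ℕ) ⊆
        Finset.range p := by
      intro i hi
      rw [Finset.mem_range]
      by_contra hip
      exact hp (μ.up_left_mem (by omega) (by omega) ((hiff i).1 hi))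
    have := Finset.card_le_card hsub
    rw [Finset.card_range] at this
    omega

/-- A self-conjugate partition is determined by its arm lengths. -/
theorem eq_of_arms_eq {μ ν : YoungDiagram} (hμ : IsSelfConjugate μ) (hν : IsSelfConjugate ν)
    (h : arms μ = arms ν) : μ = ν := by
  have key : ∀ i m, (i, i + m) ∈ μ ↔ (i, i + m) ∈ ν := fun i m => by
    rw [mem_diagonal_iff_lt_tailCard, mem_diagonal_iff_lt_tailCard, h]
  have key' : ∀ i j, (i, j) ∈ μ ↔ (i, j) ∈ ν := by
    intro i j
    rcases le_total i j with hij | hij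
    · obtain ⟨m, rfl⟩ := Nat.exists_eq_add_of_le hij
      exact key i m
    · obtain ⟨m, rfl⟩ := Nat.exists_eq_add_of_le hij
      rw [hμ.mem_comm, hν.mem_comm]
      exact key j m
  apply YoungDiagram.ext
  ext ⟨i, j⟩
  exact key' i j

theorem tailCard_le_add (D : Finset ℕ) (m k : ℕ) : tailCard D m ≤ tailCard D (m + k) + k := by
  induction k with
  | zero => simp
  | succ k ih =>
    have := tailCard_succ D (m + k)
    rw [← add_assoc m k 1]
    split_ifs at this <;> omega

theorem tailCard_le_card (D : Finset ℕ) (m : ℕ) : tailCard D m ≤ D.card :=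
  Finset.card_le_card (Finset.filter_subset _ _)

theorem le_sup_of_tailCard_pos {D : Finset ℕ} {m : ℕ} (h : 0 < tailCard D m) :
    m ≤ D.sup id := by
  obtain ⟨x, hx⟩ := Finset.card_pos.1 h
  rw [Finset.mem_filter] at hx
  exact hx.2.trans (Finset.le_sup (f := id) hx.1)

/-- The self-conjugate diagram with a given set `D` of arm lengths: the diagonals at distance `m`
from the main one get as many cells as there are elements `≥ m` in `D`. The square that bounds
the cells only serves to make the set finite. -/
def ofArms (D : Finset ℕ) : YoungDiagram where
  cells := {c ∈ Finset.range (D.card + D.sup id) ×ˢ Finset.range (D.card + D.sup id) |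
    min c.1 c.2 < tailCard D (max c.1 c.2 - min c.1 c.2)}
  isLowerSet := by
    rintro ⟨i', j'⟩ ⟨i, j⟩ ⟨hi, hj⟩ h
    simp only [Finset.coe_filter, Finset.mem_product, Finset.mem_range, Set.mem_ofPred_eq]
      at h hi hj ⊢
    obtain ⟨⟨h1, h2⟩, h3⟩ := h
    refine ⟨⟨by omega, by omega⟩, ?_⟩
    rcases le_or_gt (max i j - min i j) (max i' j' - min i' j') with hd | hd
    · have := tailCard_anti D hd
      omega
    · obtain ⟨k, hk⟩ := Nat.exists_eq_add_of_lt hd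
      have := tailCard_le_add D (max i' j' - min i' j') (k + 1)
      rw [show max i' j' - min i' j' + (k + 1) = max i j - min i j by omega] at this
      omega

theorem mem_ofArms_iff {D : Finset ℕ} {i j : ℕ} :
    (i, j) ∈ ofArms D ↔ min i j < tailCard D (max i j - min i j) := by
  rw [← YoungDiagram.mem_cells, ofArms]
  simp only [Finset.mem_filter, Finset.mem_product, Finset.mem_range, and_iff_right_iff_imp]
  intro h
  have h1 := tailCard_le_card D (max i j - min i j)
  have h2 := le_sup_of_tailCard_pos (Nat.zero_lt_of_lt h)
  omega

theorem isSelfConjugate_ofArms (D : Finset ℕ) : IsSelfConjugate (ofArms D) := by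
  apply YoungDiagram.ext
  ext ⟨i, j⟩
  rw [YoungDiagram.mem_cells, YoungDiagram.mem_cells, YoungDiagram.mem_transpose, Prod.swap_prod_mk,
    mem_ofArms_iff, mem_ofArms_iff, min_comm, max_comm]

theorem arms_ofArms (D : Finset ℕ) : arms (ofArms D) = D := by
  have h : ∀ m, tailCard (arms (ofArms D)) m = tailCard D m := by
    intro m
    refine eq_of_forall_lt_iff fun p => ?_
    rw [← mem_diagonal_iff_lt_tailCard, mem_ofArms_iff, min_eq_left (by omega),
      max_eq_right (by omega), Nat.add_sub_cancel_left]
  ext x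
  have h1 := tailCard_succ D x
  have h2 := tailCard_succ (arms (ofArms D)) x
  rw [h, h] at h2
  by_cases hx : x ∈ D <;> by_cases hx' : x ∈ arms (ofArms D) <;> simp_all

/-! ### Core conditions in terms of the arms -/

/-- The conditions on a set of arm lengths that characterize the partitions in `DS t`. -/
structure IsAdmissible (t : ℕ) (D : Finset ℕ) : Prop where
  lt : ∀ a ∈ D, a < t
  succ_notMem : ∀ a ∈ D, a + 1 ∉ D
  add_add_one_ne : ∀ a ∈ D, ∀ b ∈ D, a + b + 1 ≠ t
  add_ne : ∀ a ∈ D, ∀ b ∈ D, a + b ≠ t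

/-- Every natural number `x` is either an arm length or the label `j - colLen j` of a column to the
right of the Durfee square: follow the `x`-th diagonal to the point where it leaves `μ`. -/
theorem mem_arms_or_exists_colLen_add (μ : YoungDiagram) (x : ℕ) :
    x ∈ arms μ ∨ ∃ j, μ.colLen j + x = j := by
  have hex : ∃ p, (p, p + x) ∉ μ := by
    refine ⟨durfeeSize μ, fun h => ?_⟩
    exact lt_irrefl _ ((diag_mem_iff μ _).1 (μ.up_left_mem le_rfl (Nat.le_add_right _ x) h))
  classical
  have hspec := Nat.find_spec hex
  have hmin := fun m => Nat.find_min hex (m := m)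
  generalize Nat.find hex = p at hspec hmin
  rw [YoungDiagram.mem_iff_lt_colLen, not_lt] at hspec
  rcases Nat.eq_zero_or_pos p with rfl | hp
  · exact Or.inr ⟨0 + x, by omega⟩
  · obtain ⟨p, rfl⟩ : ∃ k, p = k + 1 := ⟨p - 1, by omega⟩
    have h1 := hmin p (Nat.lt_succ_self p)
    rw [not_not] at h1
    by_cases h2 : (p, p + 1 + x) ∈ μ
    · rw [YoungDiagram.mem_iff_lt_colLen] at h2
      exact Or.inr ⟨p + 1 + x, by omega⟩
    · rw [YoungDiagram.mem_iff_lt_rowLen] at h1 h2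
      exact Or.inl (mem_arms_iff.2 ⟨p, by omega⟩)

theorem IsCore.sub_mem_arms {t : ℕ} {μ : YoungDiagram} (h : IsCore t μ) (ht : 0 < t) {a : ℕ}
    (ha : a ∈ arms μ) (hta : t ≤ a) : a - t ∈ arms μ := by
  refine (mem_arms_or_exists_colLen_add μ (a - t)).resolve_right ?_
  rintro ⟨j, hj⟩
  obtain ⟨i, hi⟩ := mem_arms_iff.1 ha
  have hmem : (i, j) ∈ μ := by
    by_contra hn
    have h1 := hn
    rw [YoungDiagram.mem_iff_lt_colLen] at h1
    rw [YoungDiagram.mem_iff_lt_rowLen] at hn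
    omega
  refine h (i, j) ((YoungDiagram.mem_cells _).2 hmem) ?_
  have h1 := YoungDiagram.mem_iff_lt_colLen.1 hmem
  have h2 := YoungDiagram.mem_iff_lt_rowLen.1 hmem
  have : hookLength μ i j = t := by
    rw [hookLength]
    omega
  exact this ▸ dvd_rfl

theorem IsCore.not_dvd_add_add_one {t : ℕ} {μ : YoungDiagram} (hμ : IsSelfConjugate μ)
    (h : IsCore t μ) {a b : ℕ} (ha : a ∈ arms μ) (hb : b ∈ arms μ) : ¬ t ∣ a + b + 1 := by
  wlog hab : b ≤ a generalizing a b
  · rw [add_comm a b]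
    exact this hb ha (le_of_not_ge hab)
  obtain ⟨i, hi⟩ := mem_arms_iff.1 ha
  obtain ⟨j, hj⟩ := mem_arms_iff.1 hb
  have hmem : (i, j) ∈ μ := by
    rcases le_total i j with hij | hij
    · refine μ.up_left_mem hij le_rfl (μ.mem_iff_lt_rowLen.2 ?_)
      omega
    · refine μ.up_left_mem le_rfl hij (μ.mem_iff_lt_rowLen.2 ?_)
      omega
  have := h (i, j) ((YoungDiagram.mem_cells _).2 hmem)
  have h1 := YoungDiagram.mem_iff_lt_rowLen.1 hmem
  have h2 := YoungDiagram.mem_iff_lt_colLen.1 hmem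
  rw [hμ.colLen_eq] at h2
  have heq : a + b + 1 = hookLength μ i j := by
    rw [hookLength, hμ.colLen_eq]
    omega
  rwa [heq]

theorem injOn_rowLen_iff (μ : YoungDiagram) :
    Set.InjOn μ.rowLen (Set.Iio (durfeeSize μ)) ↔ ∀ a ∈ arms μ, a + 1 ∉ arms μ := by
  constructor
  · intro h a ha hb
    obtain ⟨i, hi⟩ := mem_arms_iff.1 ha
    obtain ⟨j, hj⟩ := mem_arms_iff.1 hb
    have hi' : i < durfeeSize μ := (diag_mem_iff μ i).1 (μ.mem_iff_lt_rowLen.2 (by omega))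
    have hj' : j < durfeeSize μ := (diag_mem_iff μ j).1 (μ.mem_iff_lt_rowLen.2 (by omega))
    have hne : μ.rowLen i ≠ μ.rowLen j := by
      intro heq
      have := h hi' hj' heq
      omega
    rcases lt_trichotomy i j with hij | rfl | hij
    · have := μ.rowLen_anti _ _ hij.le
      omega
    · omega
    · have := μ.rowLen_anti _ _ hij.le
      omega
  · intro h i hi j hj hij
    wlog hlt : i < j generalizing i j
    · rcases lt_trichotomy i j with h1 | h1 | h1
      · exact this hi hj hij h1
      · exact h1
      · exact (this hj hi hij.symm h1).symm
    exfalso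
    rw [Set.mem_Iio] at hi hj
    have hlen := lt_rowLen_of_lt_durfeeSize hj
    have h1 := μ.rowLen_anti _ _ (Nat.le_succ i)
    have h2 := μ.rowLen_anti _ _ (Nat.succ_le_of_lt hlt)
    refine h (μ.rowLen i - (i + 2)) (mem_arms_iff.2 ⟨i + 1, ?_⟩) (mem_arms_iff.2 ⟨i, ?_⟩)
    · simp only [Nat.succ_eq_add_one] at h1 h2
      omega
    · omega

/-- All hook lengths inside the Durfee square are of the form `a + b + 1` with arm lengths `a`, `b`;
those outside are at most the arm length of their row or column, hence smaller than `t`. -/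
theorem IsAdmissible.isCore {t s : ℕ} {μ : YoungDiagram} (hμ : IsSelfConjugate μ)
    (h : IsAdmissible t (arms μ)) (hs : s = t ∨ s = t + 1) : IsCore s μ := by
  have hlt : ∀ i, i < durfeeSize μ → μ.rowLen i < i + 1 + t := by
    intro i hi
    have h1 := lt_rowLen_of_lt_durfeeSize hi
    have := h.lt (μ.rowLen i - (i + 1)) (mem_arms_iff.2 ⟨i, by omega⟩)
    omega
  -- Right of the Durfee square the hook length is at most the arm length of its row.
  have hout : ∀ i j, i < durfeeSize μ → durfeeSize μ ≤ j → μ.rowLen j ≤ j := by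
    intro i j hi hj
    by_contra hc
    have := (diag_mem_iff μ j).1 (μ.mem_iff_lt_rowLen.2 (by omega))
    omega
  rintro ⟨i, j⟩ hc hdvd
  rw [YoungDiagram.mem_cells] at hc
  have h1 := YoungDiagram.mem_iff_lt_rowLen.1 hc
  have h2 := YoungDiagram.mem_iff_lt_colLen.1 hc
  rw [hμ.colLen_eq] at h2
  simp only [hookLength, hμ.colLen_eq] at hdvd
  have hpos : 0 < (μ.rowLen i - (j + 1)) + (μ.rowLen j - (i + 1)) + 1 := Nat.succ_pos _
  have hle := Nat.le_of_dvd hpos hdvd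
  rcases lt_or_ge i (durfeeSize μ) with hi | hi <;> rcases lt_or_ge j (durfeeSize μ) with hj | hj
  · have hi1 := hlt i hi
    have hj1 := hlt j hj
    have hi2 := lt_rowLen_of_lt_durfeeSize hi
    have hj2 := lt_rowLen_of_lt_durfeeSize hj
    have hi3 : μ.rowLen i - (i + 1) ∈ arms μ := mem_arms_iff.2 ⟨i, by omega⟩
    have hj3 : μ.rowLen j - (j + 1) ∈ arms μ := mem_arms_iff.2 ⟨j, by omega⟩
    have h3 := h.add_add_one_ne _ hi3 _ hj3
    have h4 := h.add_ne _ hi3 _ hj3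
    obtain ⟨k, hk⟩ := hdvd
    have hk2 : k < 2 := by
      by_contra hk2
      have : s * 2 ≤ s * k := Nat.mul_le_mul_left s (not_lt.1 hk2)
      omega
    interval_cases k <;> omega
  · have := hlt i hi
    have := hout i j hi hj
    omega
  · have := hlt j hj
    have := hout j i hj hi
    omega
  · have hd : (durfeeSize μ, durfeeSize μ) ∈ μ := μ.up_left_mem hi hj hc
    exact absurd ((diag_mem_iff μ _).1 hd) (lt_irrefl _)

/-- The main diagonal hooks of a partition in `DS t` have arms shorter than `t`: an arm `a > t`
would produce the consecutive arms `a - t - 1` and `a - t`, while the arm `t` would produce the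
arm `0` and with it a hook of length `t + 1`. -/
theorem mem_DS_iff {t : ℕ} (ht : 0 < t) {μ : YoungDiagram} :
    μ ∈ DS t ↔ IsSelfConjugate μ ∧ IsAdmissible t (arms μ) := by
  constructor
  · rintro ⟨hμ, h1, h2, h3⟩
    rw [injOn_rowLen_iff] at h3
    refine ⟨hμ, fun a ha => ?_, h3, fun a ha b hb hab => ?_, fun a ha b hb hab => ?_⟩
    · by_contra hta
      have h4 := h1.sub_mem_arms ht ha (not_lt.1 hta)
      rcases Nat.eq_or_lt_of_le (not_lt.1 hta) with rfl | hlt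
      · rw [Nat.sub_self] at h4
        exact h2.not_dvd_add_add_one hμ ha h4 (by simp)
      · have h5 := h2.sub_mem_arms (Nat.succ_pos t) ha hlt
        refine h3 _ h5 ?_
        rwa [show a - (t + 1) + 1 = a - t by omega]
    · exact h1.not_dvd_add_add_one hμ ha hb (hab ▸ dvd_rfl)
    · exact h2.not_dvd_add_add_one hμ ha hb (hab ▸ dvd_rfl)
  · rintro ⟨hμ, h⟩
    exact ⟨hμ, h.isCore hμ (Or.inl rfl), h.isCore hμ (Or.inr rfl),
      (injOn_rowLen_iff μ).2 h.succ_notMem⟩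

/-! ### Reduction to sets of integers with gaps -/

/-- Position of the arm length `a` in the path `0, t - 1, 1, t - 2, 2, …`, counted from its end.
Two arms of an admissible set may not be at distance less than `3` in this path. -/
def pathIndex (t a : ℕ) : ℕ := if t ≤ 2 * a then 2 * a - t else t - 1 - 2 * a

/-- The arm length at position `j` from the end of the path `0, t - 1, 1, t - 2, 2, …`. -/
def pathArm (t j : ℕ) : ℕ := if j % 2 = t % 2 then (t + j) / 2 else (t - 1 - j) / 2

/-- The diagonal hook length `2 * a + 1` belonging to the arm at position `j` of the path. The
positions `j ≡ t (mod 2)` are the heavy ones. -/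
def weight (t j : ℕ) : ℕ := if j % 2 = t % 2 then t + 1 + j else t - j

/-- Sets of path positions that correspond to admissible sets of arms: position `0` carries an
arm `a` with `2 * a = t` or `2 * a + 1 = t` and is excluded, and distinct positions are at least
`3` apart. -/
structure IsSpread (t : ℕ) (S : Finset ℕ) : Prop where
  pos : ∀ j ∈ S, 0 < j
  lt : ∀ j ∈ S, j < t
  add_three_le : ∀ i ∈ S, ∀ j ∈ S, i < j → i + 3 ≤ j

theorem pathArm_pathIndex {t a : ℕ} (h : a < t) : pathArm t (pathIndex t a) = a := by
  unfold pathArm pathIndex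
  split_ifs <;> omega

theorem pathIndex_pathArm {t j : ℕ} (h : j < t) : pathIndex t (pathArm t j) = j := by
  unfold pathArm pathIndex
  split_ifs <;> omega

theorem weight_eq {t j : ℕ} (h : j < t) : weight t j = 2 * pathArm t j + 1 := by
  unfold pathArm weight
  split_ifs <;> omega

theorem IsAdmissible.isSpread {t : ℕ} {D : Finset ℕ} (h : IsAdmissible t D) :
    IsSpread t (D.image (pathIndex t)) where
  pos := by
    simp only [Finset.forall_mem_image]
    intro a ha
    have h1 := h.add_add_one_ne a ha a ha
    have h2 := h.add_ne a ha a ha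
    unfold pathIndex
    split_ifs <;> omega
  lt := by
    simp only [Finset.forall_mem_image]
    intro a ha
    have := h.lt a ha
    unfold pathIndex
    split_ifs <;> omega
  add_three_le := by
    simp only [Finset.forall_mem_image]
    intro a ha b hb hab
    have h1 := h.add_add_one_ne a ha b hb
    have h2 := h.add_ne a ha b hb
    have h3 : b ≠ a + 1 := fun hh => h.succ_notMem a ha (hh ▸ hb)
    have h4 : a ≠ b + 1 := fun hh => h.succ_notMem b hb (hh ▸ ha)
    unfold pathIndex at hab ⊢
    split_ifs at hab ⊢ <;> omega

theorem IsSpread.isAdmissible {t : ℕ} {S : Finset ℕ} (h : IsSpread t S) :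
    IsAdmissible t (S.image (pathArm t)) where
  lt := by
    simp only [Finset.forall_mem_image]
    intro i hi
    have := h.lt i hi
    unfold pathArm
    split_ifs <;> omega
  succ_notMem := by
    simp only [Finset.forall_mem_image]
    intro i hi
    simp only [Finset.mem_image, not_exists, not_and]
    intro j hj
    have h1 := h.lt i hi
    have h2 := h.lt j hj
    have h3 := h.pos i hi
    have h4 := h.pos j hj
    have h5 := h.add_three_le i hi j hj
    have h6 := h.add_three_le j hj i hi
    unfold pathArm
    split_ifs <;> omega
  add_add_one_ne := by
    simp only [Finset.forall_mem_image]
    intro i hi j hj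
    have h1 := h.lt i hi
    have h2 := h.lt j hj
    have h3 := h.pos i hi
    have h4 := h.pos j hj
    have h5 := h.add_three_le i hi j hj
    have h6 := h.add_three_le j hj i hi
    unfold pathArm
    split_ifs <;> omega
  add_ne := by
    simp only [Finset.forall_mem_image]
    intro i hi j hj
    have h1 := h.lt i hi
    have h2 := h.lt j hj
    have h3 := h.pos i hi
    have h4 := h.pos j hj
    have h5 := h.add_three_le i hi j hj
    have h6 := h.add_three_le j hj i hi
    unfold pathArm
    split_ifs <;> omega

theorem IsAdmissible.image_pathArm_image {t : ℕ} {D : Finset ℕ} (h : IsAdmissible t D) :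
    (D.image (pathIndex t)).image (pathArm t) = D := by
  rw [Finset.image_image]
  conv_rhs => rw [← Finset.image_id (s := D)]
  exact Finset.image_congr fun a ha => pathArm_pathIndex (h.lt a ha)

theorem IsSpread.sum_weight {t : ℕ} {S : Finset ℕ} (h : IsSpread t S) :
    ∑ j ∈ S, weight t j = ∑ a ∈ S.image (pathArm t), (2 * a + 1) := by
  rw [Finset.sum_image]
  · exact Finset.sum_congr rfl fun j hj => weight_eq (h.lt j hj)
  · intro i hi j hj hij
    rw [← pathIndex_pathArm (h.lt i hi), hij, pathIndex_pathArm (h.lt j hj)]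

/-- `S` is the only spread set of largest total weight. -/
def IsUniqueOptimum (t : ℕ) (S : Finset ℕ) : Prop :=
  IsSpread t S ∧ ∀ S', IsSpread t S' → S' ≠ S → ∑ j ∈ S', weight t j < ∑ j ∈ S, weight t j

theorem IsUniqueOptimum.isGreatest_and_existsUnique {t : ℕ} (ht : 0 < t) {S : Finset ℕ}
    (h : IsUniqueOptimum t S) :
    IsGreatest (sizes t) (∑ j ∈ S, weight t j) ∧
      ∃! μ : YoungDiagram, μ ∈ DS t ∧ μ.card = ∑ j ∈ S, weight t j := by
  obtain ⟨hS, hopt⟩ := h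
  set μ := ofArms (S.image (pathArm t)) with hμ
  have hsc : IsSelfConjugate μ := isSelfConjugate_ofArms _
  have harms : arms μ = S.image (pathArm t) := arms_ofArms _
  have hmem : μ ∈ DS t := (mem_DS_iff ht).2 ⟨hsc, harms ▸ hS.isAdmissible⟩
  have hcard : μ.card = ∑ j ∈ S, weight t j := by
    rw [hsc.card_eq, harms, hS.sum_weight]
  have key : ∀ ν ∈ DS t, ν ≠ μ → ν.card < ∑ j ∈ S, weight t j := by
    intro ν hν hne
    obtain ⟨h1, h2⟩ := (mem_DS_iff ht).1 hν
    have h3 := h2.isSpread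
    have h4 : ν.card = ∑ j ∈ (arms ν).image (pathIndex t), weight t j := by
      rw [h3.sum_weight, h2.image_pathArm_image, h1.card_eq]
    rw [h4]
    refine hopt _ h3 fun heq => hne (eq_of_arms_eq h1 hsc ?_)
    rw [harms, ← heq, h2.image_pathArm_image]
  refine ⟨⟨⟨μ, hmem, hcard⟩, ?_⟩, μ, ⟨hmem, hcard⟩, ?_⟩
  · rintro _ ⟨ν, hν, rfl⟩
    by_cases hne : ν = μ
    · rw [hne, hcard]
    · exact (key ν hν hne).le
  · rintro ν ⟨hν, hc⟩
    by_contra hne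
    exact (key ν hν hne).ne hc

/-! ### Certificates for weighted sets with gaps -/

/-- Dynamic programming certificate: if `G` is a supersolution of the recursion for the largest
total weight of a subset of `{1, …, n}` with gaps at least `3`, then `G n` bounds this weight, and
equality is only possible inside the set of positions at which the recursion is tight. -/
theorem sum_le_of_certificate {w G : ℕ → ℚ} {N : ℕ} {T : Finset ℕ} (h0 : G 0 = 0)
    (hmono : ∀ n < N, G n ≤ G (n + 1))
    (htight : ∀ n ∈ T, n ≤ N → w n + G (n - 3) ≤ G n)
    (hstrict : ∀ n, 0 < n → n ≤ N → n ∉ T → w n + G (n - 3) < G n) :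
    ∀ n ≤ N, ∀ S : Finset ℕ, (∀ j ∈ S, 0 < j) → (∀ j ∈ S, j ≤ n) →
      (∀ i ∈ S, ∀ j ∈ S, i < j → i + 3 ≤ j) →
      ∑ j ∈ S, w j ≤ G n ∧ (∑ j ∈ S, w j = G n → S ⊆ T) := by
  intro n
  induction n using Nat.strong_induction_on with
  | _ n ih =>
    intro hn S hpos hle hgap
    by_cases hnS : n ∈ S
    · have hn0 := hpos n hnS
      have h := ih (n - 3) (by omega) (by omega) (S.erase n)
        (fun j hj => hpos j (Finset.mem_of_mem_erase hj))
        (fun j hj => by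
          have h1 := hle j (Finset.mem_of_mem_erase hj)
          have h2 := hgap j (Finset.mem_of_mem_erase hj) n hnS
          have h3 := Finset.ne_of_mem_erase hj
          omega)
        (fun i hi j hj => hgap i (Finset.mem_of_mem_erase hi) j (Finset.mem_of_mem_erase hj))
      rw [← Finset.add_sum_erase S w hnS]
      by_cases hT : n ∈ T
      · have h1 := htight n hT hn
        refine ⟨by linarith [h.1], fun heq => ?_⟩
        rw [← Finset.insert_erase hnS]
        exact Finset.insert_subset hT (h.2 (le_antisymm h.1 (by linarith)))
      · have h1 := hstrict n hn0 hn hT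
        exact ⟨by linarith [h.1], fun heq => by linarith [h.1]⟩
    · have hlt : ∀ j ∈ S, j < n := fun j hj =>
        lt_of_le_of_ne (hle j hj) fun hh => hnS (hh ▸ hj)
      rcases Nat.eq_zero_or_pos n with rfl | hn0
      · have : S = ∅ := Finset.eq_empty_of_forall_notMem fun j hj => by
          have := hlt j hj
          omega
        simp [this, h0]
      · obtain ⟨m, rfl⟩ : ∃ m, n = m + 1 := ⟨n - 1, by omega⟩
        have h := ih m (by omega) (by omega) S hpos
          (fun j hj => Nat.le_of_lt_succ (hlt j hj)) hgap
        have h1 := hmono m (by omega)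
        exact ⟨h.1.trans h1, fun heq => h.2 (le_antisymm h.1 (by linarith))⟩

/-- A certificate whose final value is attained by the set of its tight positions proves that this
set is the unique optimum. -/
theorem isUniqueOptimum_of_certificate {t : ℕ} (ht : 0 < t) {G : ℕ → ℚ} {T : Finset ℕ}
    (hT : IsSpread t T) (h0 : G 0 = 0) (hsum : ∑ j ∈ T, (weight t j : ℚ) = G (t - 1))
    (hmono : ∀ n < t - 1, G n ≤ G (n + 1))
    (htight : ∀ n ∈ T, weight t n + G (n - 3) ≤ G n)
    (hstrict : ∀ n, 0 < n → n < t → n ∉ T → weight t n + G (n - 3) < G n) :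
    IsUniqueOptimum t T := by
  refine ⟨hT, fun S hS hne => ?_⟩
  obtain ⟨h1, h2⟩ := sum_le_of_certificate (w := fun j => (weight t j : ℚ)) (N := t - 1) h0 hmono
    (fun n hn _ => htight n hn) (fun n hn hnt => hstrict n hn (by omega)) (t - 1) le_rfl S hS.pos
    (fun j hj => by
      have := hS.lt j hj
      omega) hS.add_three_le
  rw [← hsum] at h1 h2
  norm_cast at h1 h2
  refine lt_of_le_of_ne h1 fun heq => ?_
  obtain ⟨j, hjT, hjS⟩ := Finset.exists_of_ssubset (lt_of_le_of_ne (h2 heq) hne)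
  have h3 : ∑ j ∈ S, weight t j < ∑ j ∈ T, weight t j :=
    Finset.sum_lt_sum_of_subset (h2 heq) hjT hjS
      (by rw [weight_eq (hT.lt j hjT)]; omega) fun _ _ _ => Nat.zero_le _
  exact h3.ne heq

/-! ### The extremal set and its certificate -/

/-- The extremal set of positions: gaps of length `3` up to position `3 * K - 2`, gaps of length `4`
from there on. -/
def extremalSet (K r : ℕ) : Finset ℕ :=
  (Finset.range K).image (fun i => 3 * i + 1) ∪
    (Finset.range r).image (fun i => 3 * K + 4 * i + 2)

theorem mem_extremalSet_iff {K r n : ℕ} :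
    n ∈ extremalSet K r ↔ (∃ i < K, n = 3 * i + 1) ∨ ∃ i < r, n = 3 * K + 4 * i + 2 := by
  simp only [extremalSet, Finset.mem_union, Finset.mem_image, Finset.mem_range, eq_comm]

theorem isSpread_extremalSet {t K r : ℕ} (ht : t = 3 * K + 4 * r) :
    IsSpread t (extremalSet K r) where
  pos n hn := by
    rcases mem_extremalSet_iff.1 hn with ⟨i, hi, rfl⟩ | ⟨i, hi, rfl⟩ <;> omega
  lt n hn := by
    rcases mem_extremalSet_iff.1 hn with ⟨i, hi, rfl⟩ | ⟨i, hi, rfl⟩ <;> omega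
  add_three_le n hn m hm hlt := by
    rcases mem_extremalSet_iff.1 hn with ⟨i, hi, rfl⟩ | ⟨i, hi, rfl⟩ <;>
      rcases mem_extremalSet_iff.1 hm with ⟨j, hj, rfl⟩ | ⟨j, hj, rfl⟩ <;> omega

/-- Total weight of the first `i` positions `1, 4, 7, …`. -/
def tripleSum (t K i : ℕ) : ℚ :=
  if i % 2 = K % 2 then i * (t + 2) else i * (t + 2) - 3 * i

/-- Total weight of the `K` positions at gap `3` and the next `i` positions at gap `4`. -/
def quadSum (t K i : ℕ) : ℚ :=
  K * (t + 2) + i * (t - 1 + 3 * K) + 2 * i * (i + 1)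

/-- Increment of the certificate between the positions `3 * i - 2` and `3 * i`. It has to exceed the
previous increment by more than `2` if `i ≡ K (mod 2)`, and to be larger than `6 * i - 2` otherwise;
the fractions `1 / 4` provide the strictness and are small enough for `incr_le_weight`. -/
def incr (K i : ℕ) : ℚ :=
  if i = 0 then 0 else if i % 2 = K % 2 then (if i = 1 then 9 / 4 else 6 * i - 21 / 4)
  else 6 * i - 7 / 4

/-- Increment of the certificate between the positions `3 * i - 2` and `3 * i - 1`. -/
def preIncr (K i : ℕ) : ℚ :=
  if i % 2 = K % 2 then 0 else incr K i

/-- Increment of the certificate between the positions `3 * K + 4 * i - 2` and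
`3 * K + 4 * i + 1`. The maximum makes the certificate monotone at `3 * K` and strict at the light
position `3 * K + 1`; the slope has to exceed `2` because of the heavy positions
`3 * K + 4 * i`. -/
def lateIncr (t K i : ℕ) : ℚ :=
  max (incr K K) (t - 3 * K - 3 / 4) + 9 / 4 * i

/-- The dynamic programming certificate for the optimality of `extremalSet K r`. It agrees with the
partial weight sums at the chosen positions; the increments after them exceed the values that
make the recursion tight by small fractions, so that it is strict at all other positions. -/
def certificate (t K n : ℕ) : ℚ :=
  if n < 3 * K then
    if n % 3 = 0 then tripleSum t K (n / 3) + incr K (n / 3)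
    else if n % 3 = 1 then tripleSum t K (n / 3 + 1)
    else tripleSum t K (n / 3 + 1) + preIncr K (n / 3 + 1)
  else if n = 3 * K then quadSum t K 0 + incr K K
  else if (n - 3 * K) % 4 < 2 then
    quadSum t K ((n - 3 * K) / 4) + lateIncr t K ((n - 3 * K) / 4)
  else quadSum t K ((n - 3 * K) / 4 + 1)

theorem tripleSum_self (t K : ℕ) : tripleSum t K K = quadSum t K 0 := by
  simp [tripleSum, quadSum]

section values
variable {t K i : ℕ}

theorem certificate_three_mul (h : i ≤ K) :
    certificate t K (3 * i) = tripleSum t K i + incr K i := by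
  unfold certificate
  rcases h.eq_or_lt with rfl | h
  · rw [if_neg (lt_irrefl _), if_pos rfl, tripleSum_self]
  · rw [if_pos (by omega), if_pos (by omega), show 3 * i / 3 = i by omega]

theorem certificate_three_mul_add_one (h : i < K) :
    certificate t K (3 * i + 1) = tripleSum t K (i + 1) := by
  unfold certificate
  rw [if_pos (by omega), if_neg (by omega), if_pos (by omega), show (3 * i + 1) / 3 = i by omega]

theorem certificate_three_mul_add_two (h : i < K) :
    certificate t K (3 * i + 2) = tripleSum t K (i + 1) + preIncr K (i + 1) := by
  unfold certificate
  rw [if_pos (by omega), if_neg (by omega), if_neg (by omega), show (3 * i + 2) / 3 = i by omega]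

theorem certificate_late_zero :
    certificate t K (3 * K + 4 * (i + 1)) = quadSum t K (i + 1) + lateIncr t K (i + 1) := by
  unfold certificate
  rw [if_neg (by omega), if_neg (by omega), if_pos (by omega),
    show (3 * K + 4 * (i + 1) - 3 * K) / 4 = i + 1 by omega]

theorem certificate_late_one :
    certificate t K (3 * K + 4 * i + 1) = quadSum t K i + lateIncr t K i := by
  unfold certificate
  rw [if_neg (by omega), if_neg (by omega), if_pos (by omega),
    show (3 * K + 4 * i + 1 - 3 * K) / 4 = i by omega]

theorem certificate_late_two :
    certificate t K (3 * K + 4 * i + 2) = quadSum t K (i + 1) := by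
  unfold certificate
  rw [if_neg (by omega), if_neg (by omega), if_neg (by omega),
    show (3 * K + 4 * i + 2 - 3 * K) / 4 = i by omega]

theorem certificate_late_three :
    certificate t K (3 * K + 4 * i + 3) = quadSum t K (i + 1) := by
  unfold certificate
  rw [if_neg (by omega), if_neg (by omega), if_neg (by omega),
    show (3 * K + 4 * i + 3 - 3 * K) / 4 = i by omega]

theorem weight_heavy {j : ℕ} (h : j % 2 = t % 2) : (weight t j : ℚ) = t + 1 + j := by
  rw [weight, if_pos h]
  push_cast
  ring

theorem weight_light {j : ℕ} (h : j % 2 ≠ t % 2) (hj : j ≤ t) : (weight t j : ℚ) = t - j := by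
  rw [weight, if_neg h, Nat.cast_sub hj]

end values

theorem quadSum_succ (t K i : ℕ) :
    quadSum t K (i + 1) = quadSum t K i + (t + 3 + 3 * K + 4 * i) := by
  unfold quadSum
  push_cast
  ring

section inequalities
variable {t K r : ℕ}

theorem parity_of_ne (ht : t = 3 * K + 4 * r) {i : ℕ} (h : i % 2 ≠ K % 2) :
    (3 * i + 1) % 2 = t % 2 ∧ (3 * i + 2) % 2 ≠ t % 2 ∧ (3 * i + 3) % 2 = t % 2 := by
  rcases Nat.mod_two_eq_zero_or_one i with h1 | h1 <;>
    rcases Nat.mod_two_eq_zero_or_one K with h2 | h2 <;> omega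

theorem tripleSum_succ (ht : t = 3 * K + 4 * r) {i : ℕ} (hi : i < K) :
    tripleSum t K (i + 1) = weight t (3 * i + 1) + tripleSum t K i := by
  by_cases h : i % 2 = K % 2
  · rw [weight_light (by omega) (by omega), tripleSum, tripleSum, if_neg (by omega), if_pos h]
    push_cast
    ring
  · rw [weight_heavy (parity_of_ne ht h).1, tripleSum, tripleSum, if_pos (by omega), if_neg h]
    push_cast
    ring

theorem incr_nonneg (K i : ℕ) : 0 ≤ incr K i := by
  unfold incr
  split_ifs with h1 h2 h3
  · exact le_rfl
  · norm_num
  · have : (2 : ℚ) ≤ i := by exact_mod_cast (by omega : 2 ≤ i)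
    linarith
  · have : (1 : ℚ) ≤ i := by exact_mod_cast (by omega : 1 ≤ i)
    linarith

theorem incr_le_weight (ht : t = 3 * K + 4 * r) (h : 9 * K ≤ t + 22) {i : ℕ} (hi : i < K) :
    incr K i ≤ weight t (3 * i + 1) := by
  have h3 : 3 * K ≤ t := by omega
  unfold incr
  split_ifs with h1 h2 h3
  · positivity
  · rw [weight_light (by omega) (by omega)]
    subst h3
    have : (7 : ℚ) ≤ t := by exact_mod_cast (by omega : 7 ≤ t)
    push_cast
    linarith
  · rw [weight_light (by omega) (by omega)]
    have : (9 * i + 18 : ℚ) ≤ t + 22 := by exact_mod_cast (by omega : 9 * i + 18 ≤ t + 22)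
    push_cast
    linarith
  · rw [weight_heavy (parity_of_ne ht h2).1]
    have : (3 * i : ℚ) ≤ t := by exact_mod_cast (by omega : 3 * i ≤ t)
    push_cast
    linarith

theorem weight_add_preIncr_lt (ht : t = 3 * K + 4 * r) {i : ℕ} (hi : i < K) :
    weight t (3 * i + 2) + (tripleSum t K i + preIncr K i) <
      tripleSum t K (i + 1) + preIncr K (i + 1) := by
  rw [tripleSum_succ ht hi]
  by_cases h : i % 2 = K % 2
  · rw [weight_heavy (by omega), weight_light (by omega) (by omega), preIncr, preIncr, if_pos h,
      if_neg (by omega), incr, if_neg (by omega), if_neg (by omega)]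
    push_cast
    linarith
  · rw [weight_light (by omega) (by omega), weight_heavy (parity_of_ne ht h).1, preIncr, preIncr, if_neg h,
      if_pos (by omega), incr]
    split_ifs <;> push_cast <;> linarith [(Nat.cast_nonneg i : (0 : ℚ) ≤ i)]

theorem weight_add_incr_lt (ht : t = 3 * K + 4 * r) {i : ℕ} (hi : i < K) :
    weight t (3 * i + 3) + (tripleSum t K i + incr K i) <
      tripleSum t K (i + 1) + incr K (i + 1) := by
  rw [tripleSum_succ ht hi]
  by_cases h : i % 2 = K % 2
  · rw [weight_light (by omega) (by omega), weight_light (by omega) (by omega)]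
    unfold incr
    split_ifs <;> first | contradiction | omega | (push_cast; linarith)
  · rw [weight_heavy (parity_of_ne ht h).2.2, weight_heavy (parity_of_ne ht h).1]
    unfold incr
    split_ifs <;> first | contradiction | omega | (subst_vars; push_cast; linarith)

theorem incr_self_lt (K : ℕ) : incr K K < 6 * K + 6 := by
  unfold incr
  split_ifs <;> linarith [(Nat.cast_nonneg K : (0 : ℚ) ≤ K)]

theorem incr_self_le (ht : t = 3 * K + 4 * r) : incr K K ≤ t + 3 + 3 * K := by
  have := incr_self_lt K
  have h3 : (3 * K : ℚ) ≤ t := by exact_mod_cast (by omega : 3 * K ≤ t)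
  unfold incr
  split_ifs <;> linarith [(Nat.cast_nonneg K : (0 : ℚ) ≤ K)]

theorem lateIncr_le (ht : t = 3 * K + 4 * r) (i : ℕ) :
    lateIncr t K i ≤ t + 3 + 3 * K + 4 * i := by
  have h1 := incr_self_le ht
  have h2 : max (incr K K) (t - 3 * K - 3 / 4 : ℚ) ≤ t + 3 + 3 * K :=
    max_le h1 (by linarith [(Nat.cast_nonneg K : (0 : ℚ) ≤ K)])
  unfold lateIncr
  linarith [(Nat.cast_nonneg i : (0 : ℚ) ≤ i)]

theorem lt_lateIncr (t K i : ℕ) : (t - 3 * K - 1 : ℚ) < lateIncr t K i := by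
  have := le_max_right (incr K K) (t - 3 * K - 3 / 4 : ℚ)
  unfold lateIncr
  linarith [(Nat.cast_nonneg i : (0 : ℚ) ≤ i)]

theorem lateIncr_le_of_le (h : t ≤ 9 * K + 12) (i : ℕ) :
    lateIncr t K i ≤ 6 * K + 45 / 4 + 9 / 4 * i := by
  have h1 := incr_self_lt K
  have h2 : (t : ℚ) ≤ 9 * K + 12 := by exact_mod_cast h
  have h3 : max (incr K K) (t - 3 * K - 3 / 4 : ℚ) ≤ 6 * K + 45 / 4 :=
    max_le (by linarith) (by linarith)
  unfold lateIncr
  linarith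

theorem preIncr_nonneg (K i : ℕ) : 0 ≤ preIncr K i := by
  unfold preIncr
  split_ifs
  exacts [le_rfl, incr_nonneg K i]

theorem preIncr_le_incr (K i : ℕ) : preIncr K i ≤ incr K i := by
  unfold preIncr
  split_ifs
  exacts [incr_nonneg K i, le_rfl]

theorem preIncr_self (K : ℕ) : preIncr K K = 0 := if_pos rfl

theorem weight_late_light (ht : t = 3 * K + 4 * r) {i : ℕ} (hi : 2 * i + 1 + 3 * K ≤ t) :
    (weight t (3 * K + (2 * i + 1)) : ℚ) = t - (3 * K + (2 * i + 1)) := by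
  rw [weight_light (by omega) (by omega)]
  push_cast
  ring

theorem weight_late_heavy (ht : t = 3 * K + 4 * r) (i : ℕ) :
    (weight t (3 * K + 2 * i) : ℚ) = t + 1 + (3 * K + 2 * i) := by
  rw [weight_heavy (by omega)]
  push_cast
  ring

theorem sum_extremalSet (ht : t = 3 * K + 4 * r) :
    ∑ j ∈ extremalSet K r, (weight t j : ℚ) = quadSum t K r := by
  have h1 : ∀ m ≤ K, ∑ i ∈ Finset.range m, (weight t (3 * i + 1) : ℚ) = tripleSum t K m := by
    intro m
    induction m with
    | zero => intro _; simp [tripleSum]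
    | succ m ih =>
      intro hm
      rw [Finset.sum_range_succ, ih (by omega), tripleSum_succ ht (by omega), add_comm]
  have h2 : ∀ m, ∑ i ∈ Finset.range m, (weight t (3 * K + 4 * i + 2) : ℚ) =
      quadSum t K m - quadSum t K 0 := by
    intro m
    induction m with
    | zero => simp
    | succ m ih =>
      have := weight_late_heavy ht (2 * m + 1)
      rw [show 3 * K + 2 * (2 * m + 1) = 3 * K + 4 * m + 2 by ring] at this
      rw [Finset.sum_range_succ, ih, quadSum_succ, this]
      push_cast
      ring
  rw [extremalSet, Finset.sum_union, Finset.sum_image (by simp), Finset.sum_image (by simp),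
    h1 K le_rfl, h2, tripleSum_self]
  · ring
  · rw [Finset.disjoint_left]
    simp only [Finset.mem_image, Finset.mem_range, not_exists, not_and]
    rintro _ ⟨i, hi, rfl⟩ j hj
    omega

theorem certificate_zero (t K : ℕ) : certificate t K 0 = 0 := by
  have := certificate_three_mul (t := t) (Nat.zero_le K)
  simpa [tripleSum, incr] using this

theorem certificate_last (ht0 : 0 < t) (ht : t = 3 * K + 4 * r) :
    certificate t K (t - 1) = quadSum t K r := by
  rcases r with _ | r
  · obtain ⟨k, rfl⟩ : ∃ k, K = k + 1 := ⟨K - 1, by omega⟩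
    rw [show t - 1 = 3 * k + 2 by omega, certificate_three_mul_add_two (by omega), preIncr_self,
      tripleSum_self, add_zero]
  · rw [show t - 1 = 3 * K + 4 * r + 3 by omega, certificate_late_three]

/-- Value of the certificate three positions before `3 * K + c` for `c = 1`, `2`. -/
theorem certificate_junction (t K : ℕ) :
    certificate t K (3 * K + 1 - 3) = quadSum t K 0 ∧
      certificate t K (3 * K + 2 - 3) = quadSum t K 0 := by
  rcases K with _ | k
  · have h : quadSum t 0 0 = 0 := by simp [quadSum]
    rw [h]
    exact ⟨certificate_zero t 0, certificate_zero t 0⟩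
  · rw [show 3 * (k + 1) + 1 - 3 = 3 * k + 1 by omega,
      show 3 * (k + 1) + 2 - 3 = 3 * k + 2 by omega, certificate_three_mul_add_one (by omega),
      certificate_three_mul_add_two (by omega), preIncr_self, tripleSum_self, add_zero]
    exact ⟨rfl, rfl⟩

theorem certificate_mono (ht : t = 3 * K + 4 * r) (hl : 9 * K ≤ t + 22) (n : ℕ) :
    certificate t K n ≤ certificate t K (n + 1) := by
  rcases lt_or_ge n (3 * K) with hn | hn
  · obtain ⟨i, c, hc, rfl⟩ : ∃ i c, c < 3 ∧ n = 3 * i + c :=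
      ⟨n / 3, n % 3, by omega, by omega⟩
    have hi : i < K := by omega
    interval_cases c
    · rw [add_zero, certificate_three_mul hi.le, certificate_three_mul_add_one hi,
        tripleSum_succ ht hi]
      linarith [incr_le_weight ht hl hi]
    · rw [certificate_three_mul_add_one hi, certificate_three_mul_add_two hi]
      linarith [preIncr_nonneg K (i + 1)]
    · rw [certificate_three_mul_add_two hi, show 3 * i + 2 + 1 = 3 * (i + 1) by ring,
        certificate_three_mul hi]
      linarith [preIncr_le_incr K (i + 1)]
  · obtain ⟨i, c, hc, rfl⟩ : ∃ i c, c < 4 ∧ n = 3 * K + 4 * i + c :=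
      ⟨(n - 3 * K) / 4, (n - 3 * K) % 4, by omega, by omega⟩
    interval_cases c
    · rcases i with _ | i
      · rw [add_zero, certificate_late_one (i := 0), mul_zero, add_zero, certificate_three_mul le_rfl,
          tripleSum_self]
        have := le_max_left (incr K K) (t - 3 * K - 3 / 4 : ℚ)
        simp only [lateIncr]
        push_cast
        linarith
      · rw [certificate_late_one, add_zero, certificate_late_zero]
    · rw [certificate_late_one, certificate_late_two, quadSum_succ]
      linarith [lateIncr_le ht i]
    · rw [certificate_late_two, certificate_late_three]
    · rw [certificate_late_three, show 3 * K + 4 * i + 3 + 1 = 3 * K + 4 * (i + 1) by ring,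
        certificate_late_zero]
      linarith [incr_nonneg K K, le_max_left (incr K K) (t - 3 * K - 3 / 4 : ℚ),
        (Nat.cast_nonneg (i + 1) : (0 : ℚ) ≤ ((i + 1 : ℕ) : ℚ)),
        show lateIncr t K (i + 1) = max (incr K K) (t - 3 * K - 3 / 4 : ℚ) +
          9 / 4 * ((i + 1 : ℕ) : ℚ) from rfl]

theorem certificate_tight (ht : t = 3 * K + 4 * r) {n : ℕ} (hn : n ∈ extremalSet K r) :
    weight t n + certificate t K (n - 3) ≤ certificate t K n := by
  rcases mem_extremalSet_iff.1 hn with ⟨i, hi, rfl⟩ | ⟨i, hi, rfl⟩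
  · rw [certificate_three_mul_add_one hi, tripleSum_succ ht hi]
    rcases i with _ | i
    · rw [show 3 * 0 + 1 - 3 = 0 by omega, certificate_zero]
      simp [tripleSum]
    · rw [show 3 * (i + 1) + 1 - 3 = 3 * i + 1 by omega, certificate_three_mul_add_one (by omega)]
  · have hw := weight_late_heavy ht (2 * i + 1)
    rw [show 3 * K + 2 * (2 * i + 1) = 3 * K + 4 * i + 2 by ring] at hw
    rw [certificate_late_two, quadSum_succ, hw]
    have : certificate t K (3 * K + 4 * i + 2 - 3) = quadSum t K i := by
      rcases i with _ | i
      · exact (certificate_junction t K).2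
      · rw [show 3 * K + 4 * (i + 1) + 2 - 3 = 3 * K + 4 * i + 3 by omega, certificate_late_three]
    rw [this]
    push_cast
    linarith

theorem certificate_strict (ht : t = 3 * K + 4 * r) (hu : t ≤ 9 * K + 12) {n : ℕ} (hn0 : 0 < n)
    (hnt : n < t) (hn : n ∉ extremalSet K r) :
    weight t n + certificate t K (n - 3) < certificate t K n := by
  rw [mem_extremalSet_iff] at hn
  push Not at hn
  obtain ⟨hn1, hn2⟩ := hn
  rcases le_or_gt n (3 * K) with hnK | hnK
  · obtain ⟨i, c, hc, rfl⟩ : ∃ i c, c < 3 ∧ n = 3 * i + c + 1 :=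
      ⟨(n - 1) / 3, (n - 1) % 3, by omega, by omega⟩
    have hi : i < K := by omega
    interval_cases c
    · exact absurd rfl (hn1 i hi)
    · rw [show 3 * i + 1 + 1 = 3 * i + 2 by ring, certificate_three_mul_add_two hi]
      convert weight_add_preIncr_lt ht hi using 2
      rcases i with _ | i
      · rw [show 3 * 0 + 2 - 3 = 0 by omega, certificate_zero]
        simp [tripleSum, preIncr, incr]
      · rw [show 3 * (i + 1) + 2 - 3 = 3 * i + 2 by omega,
          certificate_three_mul_add_two (by omega)]
    · rw [show 3 * i + 2 + 1 - 3 = 3 * i by omega, show 3 * i + 2 + 1 = 3 * (i + 1) by ring,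
        certificate_three_mul hi, certificate_three_mul hi.le]
      exact weight_add_incr_lt ht hi
  · obtain ⟨i, c, hc, rfl⟩ : ∃ i c, c < 4 ∧ n = 3 * K + 4 * i + c + 1 :=
      ⟨(n - 3 * K - 1) / 4, (n - 3 * K - 1) % 4, by omega, by omega⟩
    have hi0 : (0 : ℚ) ≤ i := Nat.cast_nonneg i
    have hK0 : (0 : ℚ) ≤ K := Nat.cast_nonneg K
    interval_cases c
    · have hw := weight_late_light ht (i := 2 * i) (by omega)
      rw [show 3 * K + (2 * (2 * i) + 1) = 3 * K + 4 * i + 1 by ring] at hw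
      have : certificate t K (3 * K + 4 * i + 1 - 3) = quadSum t K i := by
        rcases i with _ | i
        · exact (certificate_junction t K).1
        · rw [show 3 * K + 4 * (i + 1) + 1 - 3 = 3 * K + 4 * i + 2 by omega, certificate_late_two]
      rw [add_zero, certificate_late_one, this, hw]
      have := lt_lateIncr t K i
      push_cast
      linarith
    · exact absurd rfl (hn2 i (by omega))
    · have hw := weight_late_light ht (i := 2 * i + 1) (by omega)
      rw [show 3 * K + (2 * (2 * i + 1) + 1) = 3 * K + 4 * i + 3 by ring] at hw
      rw [show 3 * K + 4 * i + 2 + 1 - 3 = 3 * K + 4 * i by omega,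
        show 3 * K + 4 * i + 2 + 1 = 3 * K + 4 * i + 3 by ring, certificate_late_three,
        quadSum_succ, hw]
      push_cast
      rcases i with _ | i
      · rw [mul_zero, add_zero, certificate_three_mul le_rfl, tripleSum_self]
        have := incr_self_lt K
        push_cast
        linarith
      · rw [certificate_late_zero]
        have := lateIncr_le_of_le hu (i + 1)
        push_cast at this hi0 ⊢
        linarith [(Nat.cast_nonneg i : (0 : ℚ) ≤ i)]
    · have hw := weight_late_heavy ht (2 * i + 2)
      rw [show 3 * K + 2 * (2 * i + 2) = 3 * K + 4 * (i + 1) by ring] at hw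
      rw [show 3 * K + 4 * i + 3 + 1 - 3 = 3 * K + 4 * i + 1 by omega,
        show 3 * K + 4 * i + 3 + 1 = 3 * K + 4 * (i + 1) by ring, certificate_late_one,
        certificate_late_zero, quadSum_succ, hw]
      unfold lateIncr
      push_cast
      linarith

end inequalities

theorem isUniqueOptimum_extremalSet {t K r : ℕ} (ht0 : 0 < t) (ht : t = 3 * K + 4 * r)
    (hl : 9 * K ≤ t + 22) (hu : t ≤ 9 * K + 12) : IsUniqueOptimum t (extremalSet K r) :=
  isUniqueOptimum_of_certificate ht0 (isSpread_extremalSet ht) (certificate_zero t K)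
    ((sum_extremalSet ht).trans (certificate_last ht0 ht).symm)
    (fun n _ => certificate_mono ht hl n) (fun _ hn => certificate_tight ht hn)
    (fun _ hn0 hnt hn => certificate_strict ht hu hn0 hnt hn)

/-! ### Values of the optimum -/

theorem IsUniqueOptimum.largestSize_eq {t : ℕ} (ht : 0 < t) {S : Finset ℕ}
    (h : IsUniqueOptimum t S) : largestSize t = ∑ j ∈ S, weight t j :=
  (h.isGreatest_and_existsUnique ht).1.csSup_eq

theorem largestSize_eq_quadSum {t K r : ℕ} (ht0 : 0 < t) (ht : t = 3 * K + 4 * r)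
    (hl : 9 * K ≤ t + 22) (hu : t ≤ 9 * K + 12) : (largestSize t : ℚ) = quadSum t K r := by
  rw [(isUniqueOptimum_extremalSet ht0 ht hl hu).largestSize_eq ht0, ← sum_extremalSet ht,
    Nat.cast_sum]

/-- A finite check of unique optimality, used for the values of `t` that are not of the form
`3 * K + 4 * r`. -/
theorem isUniqueOptimum_of_forall_powerset {t : ℕ} {S : Finset ℕ} (hS : IsSpread t S)
    (h : ∀ S' ∈ (Finset.range t).powerset, (∀ j ∈ S', 0 < j) →
      (∀ i ∈ S', ∀ j ∈ S', i < j → i + 3 ≤ j) → S' ≠ S →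
      ∑ j ∈ S', weight t j < ∑ j ∈ S, weight t j) : IsUniqueOptimum t S :=
  ⟨hS, fun S' hS' => h S' (Finset.mem_powerset.2 fun j hj => Finset.mem_range.2 (hS'.lt j hj))
    hS'.pos hS'.add_three_le⟩

theorem isUniqueOptimum_one : IsUniqueOptimum 1 ∅ :=
  isUniqueOptimum_of_forall_powerset ⟨by decide, by decide, by decide⟩ (by decide)

theorem isUniqueOptimum_two : IsUniqueOptimum 2 {1} :=
  isUniqueOptimum_of_forall_powerset ⟨by decide, by decide, by decide⟩ (by decide)

theorem isUniqueOptimum_five : IsUniqueOptimum 5 {3} :=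
  isUniqueOptimum_of_forall_powerset ⟨by decide, by decide, by decide⟩ (by decide)

theorem exists_parameters {t : ℕ} (ht : 3 ≤ t) (ht5 : t ≠ 5) :
    ∃ K r, t = 3 * K + 4 * r ∧ 9 * K ≤ t + 22 ∧ t ≤ 9 * K + 12 := by
  rcases lt_or_ge t 12 with h | h
  · interval_cases t
    · exact ⟨1, 0, by omega⟩
    · exact ⟨0, 1, by omega⟩
    · omega
    · exact ⟨2, 0, by omega⟩
    · exact ⟨1, 1, by omega⟩
    · exact ⟨0, 2, by omega⟩
    · exact ⟨3, 0, by omega⟩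
    · exact ⟨2, 1, by omega⟩
    · exact ⟨1, 2, by omega⟩
  -- `K` is the largest number with `9 * K ≤ t + 22` and `K ≡ -t (mod 4)`.
  · obtain ⟨M, hM⟩ : ∃ M, M = (t + 22) / 9 := ⟨_, rfl⟩
    obtain ⟨K, hK⟩ : ∃ K, K = M - (M + t) % 4 := ⟨_, rfl⟩
    exact ⟨K, (t - 3 * K) / 4, by omega⟩

theorem exists_isUniqueOptimum {t : ℕ} (ht : 1 ≤ t) : ∃ S, IsUniqueOptimum t S := by
  by_cases h1 : t = 1
  · exact ⟨∅, h1 ▸ isUniqueOptimum_one⟩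
  by_cases h2 : t = 2
  · exact ⟨{1}, h2 ▸ isUniqueOptimum_two⟩
  by_cases h5 : t = 5
  · exact ⟨{3}, h5 ▸ isUniqueOptimum_five⟩
  obtain ⟨K, r, h, hl, hu⟩ := exists_parameters (by omega : 3 ≤ t) h5
  exact ⟨_, isUniqueOptimum_extremalSet ht h hl hu⟩

theorem quadSum_eq {t K r : ℕ} (ht : t = 3 * K + 4 * r) :
    quadSum t K r = 1 / 3 * ((t : ℚ) - 1) * (t - 3 - 4 * r) + (r + 1) * (2 * t - 1 - 2 * r) := by
  rw [quadSum, ht]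
  push_cast
  ring

end SelfConjCore

theorem theorem1p3 (t : ℕ) (ht : 1 ≤ t) :
    IsGreatest (SelfConjCore.sizes t) (SelfConjCore.largestSize t) ∧
    (t = 1 → SelfConjCore.largestSize t = 0) ∧
    (t = 2 → SelfConjCore.largestSize t = 1) ∧
    (3 ≤ t → t ≤ 5 → (SelfConjCore.largestSize t : ℤ) = 2 * (t : ℤ) - 1) ∧
    (6 ≤ t → ∀ q : ℤ, q = ⌊(2 * (t : ℚ) + 1) / 12⌋ →
      (((Even t ∧ (t : ℤ) / 2 - 1 - 2 * q ≡ 0 [ZMOD 3]) ∨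
          (Odd t ∧ ((t : ℤ) - 1) / 2 - 2 * q ≡ 2 [ZMOD 3])) →
        (SelfConjCore.largestSize t : ℚ) =
          1 / 3 * ((t : ℚ) - 1) * ((t : ℚ) + 1 - 4 * (q : ℚ)) +
            (q : ℚ) * (2 * (t : ℚ) + 1 - 2 * (q : ℚ))) ∧
      (((Even t ∧ (t : ℤ) / 2 - 1 - 2 * q ≡ 1 [ZMOD 3]) ∨
          (Odd t ∧ ((t : ℤ) - 1) / 2 - 2 * q ≡ 0 [ZMOD 3])) →
        (SelfConjCore.largestSize t : ℚ) =
          1 / 3 * ((t : ℚ) - 1) * ((t : ℚ) - 7 - 4 * (q : ℚ)) +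
            ((q : ℚ) + 2) * (2 * (t : ℚ) - 3 - 2 * (q : ℚ))) ∧
      (((Even t ∧ (t : ℤ) / 2 - 1 - 2 * q ≡ 2 [ZMOD 3]) ∨
          (Odd t ∧ ((t : ℤ) - 1) / 2 - 2 * q ≡ 1 [ZMOD 3])) →
        (SelfConjCore.largestSize t : ℚ) =
          1 / 3 * ((t : ℚ) - 1) * ((t : ℚ) - 3 - 4 * (q : ℚ)) +
            ((q : ℚ) + 1) * (2 * (t : ℚ) - 1 - 2 * (q : ℚ)))) ∧
    (∃! μ : YoungDiagram, μ ∈ SelfConjCore.DS t ∧ μ.card = SelfConjCore.largestSize t) := by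
  open SelfConjCore in
  obtain ⟨S, hS⟩ := exists_isUniqueOptimum ht
  obtain ⟨hgr, huniq⟩ := hS.isGreatest_and_existsUnique ht
  rw [← hS.largestSize_eq ht] at hgr huniq
  refine ⟨hgr, ?_, ?_, ?_, ?_, huniq⟩
  · rintro rfl
    rw [isUniqueOptimum_one.largestSize_eq ht, Finset.sum_empty]
  · rintro rfl
    rw [isUniqueOptimum_two.largestSize_eq ht]
    decide
  · intro h3 h5
    obtain rfl | h : t = 5 ∨ t ≠ 5 := eq_or_ne _ _
    · rw [isUniqueOptimum_five.largestSize_eq ht]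
      decide
    · have key : (largestSize t : ℚ) = 2 * t - 1 := by
        obtain rfl | rfl : t = 3 ∨ t = 4 := by omega
        · rw [largestSize_eq_quadSum (K := 1) (r := 0) ht (by omega) (by omega) (by omega)]
          norm_num [quadSum]
        · rw [largestSize_eq_quadSum (K := 0) (r := 1) ht (by omega) (by omega) (by omega)]
          norm_num [quadSum]
      exact_mod_cast key
  · intro h6 q hq
    obtain ⟨K, r, htK, hl, hu⟩ := exists_parameters (by omega : 3 ≤ t) (by omega)
    have hq1 : 12 * q ≤ 2 * t + 1 := by
      have := Int.floor_le ((2 * (t : ℚ) + 1) / 12)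
      rw [← hq, le_div_iff₀ (by norm_num)] at this
      rw [mul_comm 12]
      exact_mod_cast this
    have hq2 : 2 * (t : ℤ) + 1 < 12 * (q + 1) := by
      have := Int.lt_floor_add_one ((2 * (t : ℚ) + 1) / 12)
      rw [← hq, div_lt_iff₀ (by norm_num)] at this
      rw [mul_comm 12]
      exact_mod_cast this
    have hr : (r : ℤ) = q - 1 ∨ (r : ℤ) = q ∨ (r : ℤ) = q + 1 := by omega
    rw [largestSize_eq_quadSum ht htK hl hu, quadSum_eq htK]
    -- The three congruence classes correspond to `r = q - 1`, `r = q + 1` and `r = q`.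
    simp only [Int.ModEq, Nat.even_iff, Nat.odd_iff]
    refine ⟨fun h => ?_, fun h => ?_, fun h => ?_⟩
    · have hr' : (r : ℚ) = q - 1 := by exact_mod_cast (by omega : (r : ℤ) = q - 1)
      rw [hr']
      ring
    · have hr' : (r : ℚ) = q + 1 := by exact_mod_cast (by omega : (r : ℤ) = q + 1)
      rw [hr']
      ring
    · have hr' : (r : ℚ) = q := by exact_mod_cast (by omega : (r : ℤ) = q)
      rw [hr']
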